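/- Let $S$ be a real-valued $C^\infty$ function on an open neighborhood $U$ of the origin in $\mathbb{R}^2$ with $S(0,0)=0$, $\nabla S(0,0)=0$ and with Taylor expansion $\sum_{a,b}s_{ab}x^ay^b$ at the origin that is not identically zero. Let the Newton polygon $N(S)$ be the convex hull of the union of the quadrants $\{(t_1,t_2): t_1\ge a,\ t_2\ge b\}$ over all $(a,b)$ with $s_{ab}\ne 0$, and let $d=\inf\{t:(t,t)\in N(S)\}$ be the Newton distance; the line $t_1=t_2$ is called the bisectrix. For a compact edge $e$ of $N(S)$ put $S_e(x,y)=\sum_{(a,b)\in e}s_{ab}x^ay^b$. Suppose that $d>1$ and that $S$ is in superadapted coordinates, i.e. for every compact edge $e$ of $N(S)$ that intersects the bisectrix, neither $S_e(1,y)$ nor $S_e(-1,y)$ has a real zero $y\neq 0$ of order $d$ or greater. Let $\phi\in C_c^\infty(\mathbb{R}^2)$ be nonnegative, with support contained in $U$ and $\phi(0,0)>0$, and let $$J_{S,\phi}(\lambda)=\int_{\mathbb{R}^2}e^{i\lambda S(x,y)}\phi(x,y)\,dx\,dy .$$ Case 1. If the bisectrix intersects $N(S)$ in the interior of a compact edge,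 then $$\limsup_{\lambda\to+\infty}\left|\frac{J_{S,\phi}(\lambda)}{\lambda^{-1/d}}\right|>0 .$$ Case 2. If the bisectrix intersects $N(S)$ at a vertex $(d,d)$, then $$\limsup_{\lambda\to+\infty}\left|\frac{J_{S,\phi}(\lambda)}{\lambda^{-1/d}\ln\lambda}\right|>0 .$$ Case 3. If the bisectrix intersects $N(S)$ in the interior of one of the unbounded rays (horizontal or vertical) of $N(S)$, then for every $\delta>0$ $$\limsup_{\lambda\to+\infty}\left|\frac{J_{S,\phi}(\lambda)}{\lambda^{-1/d-\delta}}\right|=\infty .$$ -/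

import Mathlib

open Filter MeasureTheory
open scoped ContDiff

noncomputable section

/-- The Taylor coefficient `s_{ab} = ∂_x^a ∂_y^b S(0,0) / (a! b!)` of `S` at the origin. -/
def taylorCoeff₂ (S : ℝ × ℝ → ℝ) (a b : ℕ) : ℝ :=
  iteratedDeriv a (fun x : ℝ => iteratedDeriv b (fun y : ℝ => S (x, y)) 0) 0 /
    ((a.factorial : ℝ) * (b.factorial : ℝ))

/-- The Newton polygon `N(S)`: the convex hull of the union of the quadrants
`{(t₁, t₂) : t₁ ≥ a, t₂ ≥ b}` over all `(a, b)` with `s_{ab} ≠ 0`. -/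
def newtonPolygon (S : ℝ × ℝ → ℝ) : Set (ℝ × ℝ) :=
  convexHull ℝ {p : ℝ × ℝ | ∃ a b : ℕ, taylorCoeff₂ S a b ≠ 0 ∧ (a : ℝ) ≤ p.1 ∧ (b : ℝ) ≤ p.2}

/-- The Newton distance `d(S) = inf {t : (t, t) ∈ N(S)}`. -/
def newtonDistance (S : ℝ × ℝ → ℝ) : ℝ :=
  sInf {t : ℝ | (t, t) ∈ newtonPolygon S}

/-- The bisectrix, the line `t₁ = t₂`. -/
def bisectrix : Set (ℝ × ℝ) := {p | p.1 = p.2}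

/-- `e` is an edge (a compact one or an unbounded ray) of `N(S)`: it has more than one point and
is the set where some nonzero linear functional attains its minimum over `N(S)`. -/
def IsNewtonEdge (S : ℝ × ℝ → ℝ) (e : Set (ℝ × ℝ)) : Prop :=
  e.Nontrivial ∧ ∃ u v c : ℝ, (u, v) ≠ ((0, 0) : ℝ × ℝ) ∧
    (∀ p ∈ newtonPolygon S, c ≤ u * p.1 + v * p.2) ∧
    e = {p | p ∈ newtonPolygon S ∧ u * p.1 + v * p.2 = c}

/-- The interior of an edge: the edge without its endpoints. -/
def edgeInterior (e : Set (ℝ × ℝ)) : Set (ℝ × ℝ) := e \ e.extremePoints ℝ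

/-- For a compact edge `e` and a real number `x`, the polynomial `S_e(x, ·)` in the second variable,
where `S_e(x, y) = ∑_{(a, b) ∈ e} s_{ab} x^a y^b` (a finite sum, as `e` is bounded). -/
def edgePolynomial (S : ℝ × ℝ → ℝ) (e : Set (ℝ × ℝ)) (x : ℝ) : Polynomial ℝ :=
  ∑ᶠ (q : ℕ × ℕ) (_ : ((q.1 : ℝ), (q.2 : ℝ)) ∈ e),
    Polynomial.monomial q.2 (taylorCoeff₂ S q.1 q.2 * x ^ q.1)

/-- `S` is in superadapted coordinates: for every compact edge `e` of `N(S)` meeting the bisectrix,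
`S_e(1, y)` and `S_e(-1, y)` have no real zero of order `d(S)` or greater other than possibly
`y = 0`. -/
def IsSuperadapted (S : ℝ × ℝ → ℝ) : Prop :=
  ∀ e : Set (ℝ × ℝ), IsNewtonEdge S e → IsCompact e → (e ∩ bisectrix).Nonempty →
    ∀ r : ℝ, r ≠ 0 →
      ((edgePolynomial S e 1).rootMultiplicity r : ℝ) < newtonDistance S ∧
      ((edgePolynomial S e (-1)).rootMultiplicity r : ℝ) < newtonDistance S

/-- Case 1: the bisectrix meets `N(S)` in the interior of a compact edge. -/
def NewtonCase1 (S : ℝ × ℝ → ℝ) : Prop :=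
  ∃ e : Set (ℝ × ℝ), IsNewtonEdge S e ∧ IsCompact e ∧ (edgeInterior e ∩ bisectrix).Nonempty

/-- Case 2: the bisectrix meets `N(S)` at a vertex, which is then `(d, d)` with `d = d(S)`. -/
def NewtonCase2 (S : ℝ × ℝ → ℝ) : Prop :=
  (newtonDistance S, newtonDistance S) ∈ (newtonPolygon S).extremePoints ℝ

/-- Case 3: the bisectrix meets `N(S)` in the interior of one of the two unbounded rays. -/
def NewtonCase3 (S : ℝ × ℝ → ℝ) : Prop :=
  ∃ e : Set (ℝ × ℝ), IsNewtonEdge S e ∧ ¬ IsCompact e ∧ (edgeInterior e ∩ bisectrix).Nonempty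

/-- The oscillatory integral `J_{S,φ}(l) = ∫ e^{i l S(x,y)} φ(x,y) dx dy`. -/
def oscIntegral (S φ : ℝ × ℝ → ℝ) (l : ℝ) : ℂ :=
  ∫ p : ℝ × ℝ, Complex.exp (Complex.I * (l : ℂ) * (S p : ℂ)) * (φ p : ℂ)

end

/-! The size of `J` is bounded below on average, through the area of sublevel sets of `S`. Weighting
`Re J` by the triangle function `1 - l / R` on `[0, R]` and exchanging integrals gives `∫ K_R(S) φ`,
where `K_R(s) = (1 - cos (R s)) / (R s²)` is a Fejér kernel: it is nonnegative, and at least `R / 4`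
where `|s| ≤ 1 / R`. As `φ ≥ 0` and `φ(0) > 0`, nothing cancels, and `∫₀ᴿ |J|` is at least a
constant times `R` times the area of `{|S| ≤ 1 / R}` near the origin
(`sublevel_le_integral_norm_oscIntegral`). If that area is at least of order `R ^ (-κ) * L R` with
`κ < 1`, then `|J(l)|` cannot eventually stay below a small multiple of `l ^ (-κ) * L l`
(`exists_frequently_le_of_le_integral`). The assumption `d > 1` enters as `κ = 1 / d < 1`.

The areas come from the Newton polygon, by exhibiting explicit regions in the positive quadrant
where every Taylor monomial is at most `t`. A supporting line `p t₁ + q t₂ = 1` through `(d, d)`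
with `p, q > 0` gives the box `[0, t^p] × [0, t^q]`, of area `t^(1/d)`. On an unbounded ray one
weight may vanish, and raising both weights slightly costs an arbitrarily small power of `t`. At a
vertex a whole cone of lines supports the polygon, and the part of `{xy < t^(1/d)}` between two
curves `y = x^M` and `y = x^m` has area of order `t^(1/d) log (1/t)`. -/

/-! ### Taylor expansion in two variables. -/

theorem contDiff_iteratedDeriv_snd {f : ℝ × ℝ → ℝ} (hf : ContDiff ℝ ∞ f) (b : ℕ) :
    ContDiff ℝ ∞ (fun p : ℝ × ℝ => iteratedDeriv b (fun y => f (p.1, y)) p.2) := by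
  induction b with
  | zero => simpa using hf
  | succ b ih =>
    set F : ℝ × ℝ → ℝ := fun p => iteratedDeriv b (fun y => f (p.1, y)) p.2 with hF
    have key : (fun p : ℝ × ℝ => iteratedDeriv (b + 1) (fun y => f (p.1, y)) p.2)
        = fun p => fderiv ℝ F p (0, 1) := by
      funext p
      rw [iteratedDeriv_succ]
      have h1 : HasFDerivAt F (fderiv ℝ F p) (p.1, p.2) :=
        (ih.differentiable (by simp) p).hasFDerivAt
      have h2 : HasDerivAt (fun y : ℝ => (p.1, y)) ((0 : ℝ), (1 : ℝ)) p.2 :=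
        (hasDerivAt_const _ _).prodMk (hasDerivAt_id _)
      exact (h1.comp_hasDerivAt p.2 h2).deriv
    rw [key]
    exact (ih.fderiv_right (m := ∞) (by simp)).clm_apply contDiff_const

theorem abs_sub_taylor_le {g : ℝ → ℝ} (hg : ContDiff ℝ ∞ g) (n : ℕ) {K : ℝ}
    (hK : ∀ y ∈ Set.Icc (0 : ℝ) 1, ‖iteratedDeriv (n + 1) g y‖ ≤ K) {y : ℝ}
    (hy : y ∈ Set.Icc (0 : ℝ) 1) :
    |g y - ∑ k ∈ Finset.range (n + 1), iteratedDeriv k g 0 / (k.factorial : ℝ) * y ^ k|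
      ≤ K * y ^ (n + 1) := by
  have hu : UniqueDiffOn ℝ (Set.Icc (0 : ℝ) 1) := uniqueDiffOn_Icc zero_lt_one
  have he : ∀ k : ℕ, ∀ z ∈ Set.Icc (0 : ℝ) 1,
      iteratedDerivWithin k g (Set.Icc 0 1) z = iteratedDeriv k g z := fun k z hz =>
    iteratedDerivWithin_eq_iteratedDeriv hu ((hg.of_le (by exact_mod_cast le_top)).contDiffAt) hz
  have h := taylor_mean_remainder_bound (f := g) (n := n) (C := K) zero_le_one
    ((hg.of_le (by exact_mod_cast le_top)).contDiffOn) hy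
    (fun z hz => by rw [he _ _ hz]; exact hK z hz)
  have hs : taylorWithinEval g n (Set.Icc 0 1) 0 y
      = ∑ k ∈ Finset.range (n + 1), iteratedDeriv k g 0 / (k.factorial : ℝ) * y ^ k := by
    rw [taylor_within_apply]
    refine Finset.sum_congr rfl fun k _ => ?_
    rw [he _ _ (by simp)]
    simp only [sub_zero, smul_eq_mul]
    field_simp
  rw [hs, Real.norm_eq_abs, sub_zero] at h
  refine h.trans ?_
  have hK0 : 0 ≤ K := (norm_nonneg _).trans (hK 0 (by simp))
  have : (1 : ℝ) ≤ (n.factorial : ℝ) := by exact_mod_cast n.factorial_pos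
  exact div_le_self (mul_nonneg hK0 (pow_nonneg hy.1 _)) this

/-- Taylor expansion in `y`, then of each coefficient function in `x`. This leaves an error made of
pure powers only, which are negligible in the regions used later once `n` is large. -/
theorem exists_abs_sub_taylor₂_le {f : ℝ × ℝ → ℝ} (hf : ContDiff ℝ ∞ f) (n : ℕ) :
    ∃ C : ℝ, 0 ≤ C ∧ ∀ x ∈ Set.Icc (0 : ℝ) 1, ∀ y ∈ Set.Icc (0 : ℝ) 1,
      |f (x, y) - ∑ b ∈ Finset.range (n + 1), ∑ a ∈ Finset.range (n + 1),
        taylorCoeff₂ f a b * x ^ a * y ^ b| ≤ C * (x ^ (n + 1) + y ^ (n + 1)) := by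
  have hcomp : IsCompact (Set.Icc (0 : ℝ) 1 ×ˢ Set.Icc (0 : ℝ) 1) := isCompact_Icc.prod isCompact_Icc
  obtain ⟨K, hK⟩ := hcomp.exists_bound_of_continuousOn
    (contDiff_iteratedDeriv_snd hf (n + 1)).continuous.continuousOn
  set g : ℕ → ℝ → ℝ := fun b x => iteratedDeriv b (fun y => f (x, y)) 0 with hgdef
  have hg : ∀ b, ContDiff ℝ ∞ (g b) := fun b =>
    (contDiff_iteratedDeriv_snd hf b).comp (contDiff_id.prodMk contDiff_const)
  have hB : ∀ b, ∃ B : ℝ, ∀ x ∈ Set.Icc (0 : ℝ) 1, ‖iteratedDeriv (n + 1) (g b) x‖ ≤ B := fun b =>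
    isCompact_Icc.exists_bound_of_continuousOn
      ((hg b).continuous_iteratedDeriv (n + 1) (by exact_mod_cast le_top)).continuousOn
  choose B hB using hB
  have hB0 : ∀ b, 0 ≤ B b := fun b => (norm_nonneg _).trans (hB b 0 (by simp))
  have hK0 : 0 ≤ K := (norm_nonneg _).trans (hK (0, 0) (by simp))
  have hs0 : 0 ≤ ∑ b ∈ Finset.range (n + 1), B b := Finset.sum_nonneg fun b _ => hB0 b
  refine ⟨K + ∑ b ∈ Finset.range (n + 1), B b, by positivity, fun x hx y hy => ?_⟩
  have h1 := abs_sub_taylor_le (g := fun y => f (x, y))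
    (hf.comp (contDiff_const.prodMk contDiff_id)) n (K := K)
    (fun z hz => hK (x, z) ⟨hx, hz⟩) hy
  have h2 : |∑ b ∈ Finset.range (n + 1), g b x / (b.factorial : ℝ) * y ^ b
      - ∑ b ∈ Finset.range (n + 1), ∑ a ∈ Finset.range (n + 1),
        taylorCoeff₂ f a b * x ^ a * y ^ b|
      ≤ (∑ b ∈ Finset.range (n + 1), B b) * x ^ (n + 1) := by
    rw [← Finset.sum_sub_distrib, Finset.sum_mul]
    refine (Finset.abs_sum_le_sum_abs _ _).trans (Finset.sum_le_sum fun b _ => ?_)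
    have h3 := abs_sub_taylor_le (hg b) n (hB b) hx
    have h4 : g b x / (b.factorial : ℝ) * y ^ b - ∑ a ∈ Finset.range (n + 1),
        taylorCoeff₂ f a b * x ^ a * y ^ b = (g b x - ∑ k ∈ Finset.range (n + 1),
          iteratedDeriv k (g b) 0 / (k.factorial : ℝ) * x ^ k) * (y ^ b / (b.factorial : ℝ)) := by
      rw [sub_mul, Finset.sum_mul]
      congr 1
      · ring
      · refine Finset.sum_congr rfl fun a _ => ?_
        simp only [taylorCoeff₂, hgdef]
        field_simp
    rw [h4, abs_mul]
    have h5 : |y ^ b / (b.factorial : ℝ)| ≤ 1 := by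
      rw [abs_of_nonneg (div_nonneg (pow_nonneg hy.1 _) (by positivity))]
      refine div_le_one_of_le₀ ((pow_le_one₀ hy.1 hy.2).trans ?_) (by positivity)
      exact_mod_cast b.factorial_pos
    calc _ ≤ B b * x ^ (n + 1) * 1 :=
          mul_le_mul h3 h5 (abs_nonneg _) ((abs_nonneg _).trans h3)
      _ = _ := mul_one _
  have hx0 : 0 ≤ x ^ (n + 1) := pow_nonneg hx.1 _
  have hy0 : 0 ≤ y ^ (n + 1) := pow_nonneg hy.1 _
  refine (abs_sub_le _ (∑ b ∈ Finset.range (n + 1), g b x / (b.factorial : ℝ) * y ^ b) _).trans ?_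
  nlinarith [mul_nonneg hK0 hx0, mul_nonneg hs0 hy0]

theorem taylorCoeff₂_congr {S T : ℝ × ℝ → ℝ} (h : S =ᶠ[nhds 0] T) (a b : ℕ) :
    taylorCoeff₂ S a b = taylorCoeff₂ T a b := by
  have h1 : ∀ᶠ x : ℝ in nhds 0, ∀ᶠ y : ℝ in nhds 0, S (x, y) = T (x, y) := by
    have : ∀ᶠ p in nhds (0 : ℝ) ×ˢ nhds (0 : ℝ), S p = T p := by
      rw [← nhds_prod_eq]; exact h
    exact this.curry
  have h2 : (fun x : ℝ => iteratedDeriv b (fun y : ℝ => S (x, y)) 0) =ᶠ[nhds 0]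
      fun x : ℝ => iteratedDeriv b (fun y : ℝ => T (x, y)) 0 := by
    filter_upwards [h1] with x hx
    exact Filter.EventuallyEq.iteratedDeriv_eq b hx
  simp only [taylorCoeff₂]
  rw [h2.iteratedDeriv_eq a]

/-- Multiplication by a bump function supported in `U`. The germ at the origin is unchanged, and
Taylor bounds on the whole unit square become available. -/
theorem exists_contDiff_eventuallyEq {U : Set (ℝ × ℝ)} (hU : IsOpen U) (h0U : (0 : ℝ × ℝ) ∈ U)
    {S : ℝ × ℝ → ℝ} (hS : ContDiffOn ℝ ∞ S U) :
    ∃ T : ℝ × ℝ → ℝ, ContDiff ℝ ∞ T ∧ S =ᶠ[nhds 0] T := by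
  obtain ⟨ρ, hρ, hρU⟩ := Metric.isOpen_iff.1 hU 0 h0U
  let χ : ContDiffBump (0 : ℝ × ℝ) := ⟨ρ / 3, ρ / 2, by positivity, by linarith⟩
  have hsupp : tsupport χ ⊆ U := by
    rw [χ.tsupport_eq]
    exact (Metric.closedBall_subset_ball (by change ρ / 2 < ρ; linarith)).trans hρU
  refine ⟨fun p => χ p * S p, ?_, ?_⟩
  · refine contDiff_iff_contDiffAt.2 fun p => ?_
    by_cases hp : p ∈ tsupport χ
    · exact χ.contDiff.contDiffAt.mul (hS.contDiffAt (hU.mem_nhds (hsupp hp)))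
    · have h0 : (fun p => χ p * S p) =ᶠ[nhds p] fun _ => 0 := by
        filter_upwards [notMem_tsupport_iff_eventuallyEq.1 hp] with q hq
        simp [hq]
      exact contDiffAt_const.congr_of_eventuallyEq h0
  · filter_upwards [χ.eventuallyEq_one] with p hp
    simp [hp]

/-- A smooth function is bounded near the corner of the positive quadrant by the monomials that
occur in its Taylor expansion together with the pure powers of a given high order. -/
theorem exists_abs_le_of_monomial_le {U : Set (ℝ × ℝ)} (hU : IsOpen U)
    (h0U : (0 : ℝ × ℝ) ∈ U) {S : ℝ × ℝ → ℝ} (hS : ContDiffOn ℝ ∞ S U) (n : ℕ) :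
    ∃ C r : ℝ, 0 < C ∧ 0 < r ∧ ∀ x y t : ℝ, 0 ≤ x → x ≤ r → 0 ≤ y → y ≤ r →
      (∀ a b, taylorCoeff₂ S a b ≠ 0 → x ^ a * y ^ b ≤ t) → x ^ (n + 1) ≤ t → y ^ (n + 1) ≤ t →
      |S (x, y)| ≤ C * t := by
  obtain ⟨T, hT, hST⟩ := exists_contDiff_eventuallyEq hU h0U hS
  obtain ⟨C, hC0, hC⟩ := exists_abs_sub_taylor₂_le hT n
  obtain ⟨ρ, hρ, hρT⟩ := Metric.eventually_nhds_iff.1 hST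
  set D := ∑ b ∈ Finset.range (n + 1), ∑ a ∈ Finset.range (n + 1), |taylorCoeff₂ S a b|
  have hD : 0 ≤ D := Finset.sum_nonneg fun _ _ => Finset.sum_nonneg fun _ _ => abs_nonneg _
  refine ⟨D + 2 * C + 1, min 1 (ρ / 2), by positivity, by positivity,
    fun x y t hx hxr hy hyr hmon hxn hyn => ?_⟩
  have hx1 := hxr.trans (min_le_left _ _)
  have hy1 := hyr.trans (min_le_left _ _)
  have hx2 := hxr.trans (min_le_right _ _)
  have hy2 := hyr.trans (min_le_right _ _)
  have hEq : S (x, y) = T (x, y) := by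
    apply hρT
    rw [dist_zero_right, Prod.norm_def]
    simp only [Real.norm_eq_abs, abs_of_nonneg hx, abs_of_nonneg hy]
    exact max_lt (by linarith) (by linarith)
  have ht : 0 ≤ t := (pow_nonneg hx _).trans hxn
  have h1 := hC x ⟨hx, hx1⟩ y ⟨hy, hy1⟩
  rw [← hEq] at h1
  have h2 : |∑ b ∈ Finset.range (n + 1), ∑ a ∈ Finset.range (n + 1),
        taylorCoeff₂ T a b * x ^ a * y ^ b| ≤ D * t := by
    rw [Finset.sum_mul]
    refine (Finset.abs_sum_le_sum_abs _ _).trans (Finset.sum_le_sum fun b _ => ?_)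
    rw [Finset.sum_mul]
    refine (Finset.abs_sum_le_sum_abs _ _).trans (Finset.sum_le_sum fun a _ => ?_)
    rw [← taylorCoeff₂_congr hST, mul_assoc, abs_mul]
    by_cases h0 : taylorCoeff₂ S a b = 0
    · simp [h0]
    · rw [abs_of_nonneg (mul_nonneg (pow_nonneg hx a) (pow_nonneg hy b))]
      exact mul_le_mul_of_nonneg_left (hmon a b h0) (abs_nonneg _)
  have h3 := abs_sub_abs_le_abs_sub (S (x, y)) (∑ b ∈ Finset.range (n + 1),
    ∑ a ∈ Finset.range (n + 1), taylorCoeff₂ T a b * x ^ a * y ^ b)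
  nlinarith [mul_le_mul_of_nonneg_left hxn hC0, mul_le_mul_of_nonneg_left hyn hC0]

/-! ### Fejér means of the oscillatory integral. -/

/-- The cosine transform of the triangle function is nonnegative. -/
theorem integral_triangle_mul_cos_nonneg {R : ℝ} (hR : 0 < R) (s : ℝ) :
    0 ≤ ∫ l in (0 : ℝ)..R, (1 - l / R) * Real.cos (l * s) := by
  by_cases hs : s = 0
  · refine intervalIntegral.integral_nonneg hR.le fun l hl => ?_
    rw [hs]
    simpa using div_le_one_of_le₀ hl.2 hR.le
  -- Primitive found by parts; its increment over `[0, R]` is `(1 - cos (R s)) / (R s²)`.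
  have hderiv : ∀ l ∈ Set.uIcc 0 R, HasDerivAt
      (fun l : ℝ => (1 - l / R) * (Real.sin (l * s) / s) - Real.cos (l * s) / (R * s ^ 2))
      ((1 - l / R) * Real.cos (l * s)) l := by
    intro l _
    have hl : HasDerivAt (fun l : ℝ => l * s) s l := by simpa using (hasDerivAt_id l).mul_const s
    have h1 : HasDerivAt (fun l : ℝ => 1 - l / R) (-(1 / R)) l := by
      simpa using ((hasDerivAt_id l).div_const R).const_sub 1
    have h2 := (h1.mul (hl.sin.div_const s)).sub (hl.cos.div_const (R * s ^ 2))
    refine HasDerivAt.congr_deriv h2 ?_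
    field_simp
    ring
  rw [intervalIntegral.integral_eq_sub_of_hasDerivAt hderiv
    (Continuous.intervalIntegrable (by fun_prop) _ _)]
  have : (1 - R / R) * (Real.sin (R * s) / s) - Real.cos (R * s) / (R * s ^ 2)
      - ((1 - 0 / R) * (Real.sin (0 * s) / s) - Real.cos (0 * s) / (R * s ^ 2))
      = (1 - Real.cos (R * s)) / (R * s ^ 2) := by
    rw [div_self hR.ne']
    simp
    ring
  rw [this]
  exact div_nonneg (by linarith [Real.cos_le_one (R * s)]) (by positivity)

/-- Throughout the range of integration `|l s| ≤ 1`, so the cosine is at least `1 / 2`, while the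
triangle has mass `R / 2`. -/
theorem le_integral_triangle_mul_cos {R : ℝ} (hR : 0 < R) {s : ℝ} (hs : |s| ≤ 1 / R) :
    R / 4 ≤ ∫ l in (0 : ℝ)..R, (1 - l / R) * Real.cos (l * s) := by
  have h1 : ∫ l in (0 : ℝ)..R, (1 - l / R) * (1 / 2) = R / 4 := by
    rw [intervalIntegral.integral_mul_const, intervalIntegral.integral_sub (by simp)
      (Continuous.intervalIntegrable (by fun_prop) _ _), intervalIntegral.integral_div]
    simp
    field_simp
    ring
  rw [← h1]
  refine intervalIntegral.integral_mono_on hR.le (Continuous.intervalIntegrable (by fun_prop) _ _)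
    (Continuous.intervalIntegrable (by fun_prop) _ _) fun l hl => ?_
  have h2 : 0 ≤ 1 - l / R := by linarith [div_le_one_of_le₀ hl.2 hR.le]
  refine mul_le_mul_of_nonneg_left ?_ h2
  have h3 : |l * s| ≤ 1 := by
    rw [abs_mul, abs_of_nonneg hl.1]
    calc l * |s| ≤ R * (1 / R) := mul_le_mul hl.2 hs (abs_nonneg _) hR.le
      _ = 1 := by field_simp
  have h4 := Real.one_sub_sq_div_two_le_cos (x := l * s)
  have h5 : (l * s) ^ 2 ≤ 1 := by
    rw [← sq_abs]; exact pow_le_one₀ (abs_nonneg _) h3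
  linarith

section Average

variable {S φ : ℝ × ℝ → ℝ}

theorem norm_exp_I_mul_ofReal (l s : ℝ) : ‖Complex.exp (Complex.I * (l : ℂ) * (s : ℂ))‖ = 1 := by
  rw [show Complex.I * (l : ℂ) * (s : ℂ) = ((l * s : ℝ) : ℂ) * Complex.I by push_cast; ring]
  exact Complex.norm_exp_ofReal_mul_I _

theorem re_exp_I_mul_ofReal_mul (l s w : ℝ) :
    (Complex.exp (Complex.I * (l : ℂ) * (s : ℂ)) * (w : ℂ)).re = Real.cos (l * s) * w := by
  rw [Complex.re_mul_ofReal,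
    show Complex.I * (l : ℂ) * (s : ℂ) = ((l * s : ℝ) : ℂ) * Complex.I by push_cast; ring,
    Complex.exp_ofReal_mul_I_re]

theorem integrable_oscIntegrand (hS : Measurable S) (hφ : Integrable φ) (l : ℝ) :
    Integrable (fun p => Complex.exp (Complex.I * (l : ℂ) * (S p : ℂ)) * (φ p : ℂ)) := by
  refine hφ.norm.mono' ?_ (Eventually.of_forall fun p => ?_)
  · exact (Measurable.aestronglyMeasurable (by fun_prop)).mul hφ.ofReal.aestronglyMeasurable
  · rw [norm_mul, norm_exp_I_mul_ofReal, one_mul, Complex.norm_real]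

theorem continuous_oscIntegral (hS : Measurable S) (hφ : Integrable φ) :
    Continuous (oscIntegral S φ) := by
  refine continuous_of_dominated (bound := fun p => ‖φ p‖)
    (fun l => (integrable_oscIntegrand hS hφ l).aestronglyMeasurable)
    (fun l => Eventually.of_forall fun p => ?_) hφ.norm (Eventually.of_forall fun p => by fun_prop)
  rw [norm_mul, norm_exp_I_mul_ofReal, one_mul, Complex.norm_real]

theorem re_oscIntegral (hS : Measurable S) (hφ : Integrable φ) (l : ℝ) :
    (oscIntegral S φ l).re = ∫ p, Real.cos (l * S p) * φ p := by
  have h := integral_re (𝕜 := ℂ) (integrable_oscIntegrand hS hφ l)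
  simp only [RCLike.re_to_complex, re_exp_I_mul_ofReal_mul] at h
  exact h.symm

/-- The mean of the oscillatory integral over `[0, R]` controls the size of the sublevel set
`|S| ≤ 1 / R`. -/
theorem sublevel_le_integral_norm_oscIntegral (hS : Measurable S) (hφ : Integrable φ)
    (hφ0 : ∀ p, 0 ≤ φ p) {R c : ℝ} (hR : 0 < R) (hc : 0 ≤ c) {A : Set (ℝ × ℝ)}
    (hA : MeasurableSet A) (hAfin : volume A ≠ ⊤)
    (hAS : ∀ p ∈ A, |S p| ≤ 1 / R) (hAφ : ∀ p ∈ A, c ≤ φ p) :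
    R / 4 * c * volume.real A ≤ ∫ l in (0 : ℝ)..R, ‖oscIntegral S φ l‖ := by
  have hcont := continuous_oscIntegral hS hφ
  have h1 : ∫ l in (0 : ℝ)..R, (1 - l / R) * (oscIntegral S φ l).re
      ≤ ∫ l in (0 : ℝ)..R, ‖oscIntegral S φ l‖ := by
    refine intervalIntegral.integral_mono_on hR.le
      (Continuous.intervalIntegrable (by fun_prop) _ _)
      (Continuous.intervalIntegrable (by fun_prop) _ _) fun l hl => ?_
    have h2 : 0 ≤ 1 - l / R := by linarith [div_le_one_of_le₀ hl.2 hR.le]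
    have h3 : 1 - l / R ≤ 1 := by linarith [div_nonneg hl.1 hR.le]
    calc (1 - l / R) * (oscIntegral S φ l).re ≤ (1 - l / R) * ‖oscIntegral S φ l‖ :=
          mul_le_mul_of_nonneg_left (Complex.re_le_norm _) h2
      _ ≤ 1 * ‖oscIntegral S φ l‖ := mul_le_mul_of_nonneg_right h3 (norm_nonneg _)
      _ = _ := one_mul _
  refine le_trans ?_ h1
  have hint : Integrable (Function.uncurry fun (l : ℝ) (p : ℝ × ℝ) =>
      (1 - l / R) * (Real.cos (l * S p) * φ p))
      ((volume.restrict (Set.uIoc 0 R)).prod volume) := by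
    have hw : Integrable (fun l : ℝ => 1 - l / R) (volume.restrict (Set.uIoc 0 R)) :=
      (intervalIntegrable_iff.1 (Continuous.intervalIntegrable (by fun_prop) _ _))
    refine (hw.mul_prod hφ).norm.mono' ?_ (Eventually.of_forall fun q => ?_)
    · have hm : Measurable fun q : ℝ × (ℝ × ℝ) => Real.cos (q.1 * S q.2) := by fun_prop
      have := ((hw.mul_prod hφ).aestronglyMeasurable).mul hm.aestronglyMeasurable
      refine this.congr (Eventually.of_forall fun q => ?_)
      simp only [Function.uncurry, Pi.mul_apply]
      ring
    · simp only [Function.uncurry, norm_mul]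
      gcongr
      calc ‖Real.cos (q.1 * S q.2)‖ * ‖φ q.2‖ ≤ 1 * ‖φ q.2‖ :=
            mul_le_mul_of_nonneg_right (Real.abs_cos_le_one _) (norm_nonneg _)
        _ = _ := one_mul _
  -- Fubini turns the weighted mean into the integral of the nonnegative kernel at `S p` against
  -- `φ`, which may then be restricted to `A`.
  have h4 : ∫ l in (0 : ℝ)..R, (1 - l / R) * (oscIntegral S φ l).re
      = ∫ p, (∫ l in (0 : ℝ)..R, (1 - l / R) * Real.cos (l * S p)) * φ p := by
    simp_rw [re_oscIntegral hS hφ, ← integral_const_mul]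
    rw [intervalIntegral_integral_swap hint]
    refine integral_congr_ae (Eventually.of_forall fun p => ?_)
    simp only
    rw [← intervalIntegral.integral_mul_const]
    simp only [mul_assoc]
  have hint2 : Integrable
      (fun p => (∫ l in (0 : ℝ)..R, (1 - l / R) * Real.cos (l * S p)) * φ p) := by
    have := hint.integral_prod_right
    refine this.congr (Eventually.of_forall fun p => ?_)
    simp only [Function.uncurry]
    rw [Set.uIoc_of_le hR.le, ← intervalIntegral.integral_mul_const,
      intervalIntegral.integral_of_le hR.le]
    simp only [mul_assoc]
  rw [h4]
  calc R / 4 * c * volume.real A = ∫ p, A.indicator (fun _ => R / 4 * c) p := by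
        rw [integral_indicator hA, setIntegral_const, smul_eq_mul, mul_comm]
    _ ≤ _ := by
        refine integral_mono ((integrable_indicator_iff hA).2
          (integrableOn_const hAfin)) hint2 fun p => ?_
        by_cases hp : p ∈ A
        · rw [Set.indicator_of_mem hp]
          exact mul_le_mul (le_integral_triangle_mul_cos hR (hAS p hp)) (hAφ p hp) hc
            (integral_triangle_mul_cos_nonneg hR _)
        · rw [Set.indicator_of_notMem hp]
          exact mul_nonneg (integral_triangle_mul_cos_nonneg hR _) (hφ0 p)

end Average

/-- A function with large means is frequently large. -/
theorem exists_frequently_le_of_le_integral {f L : ℝ → ℝ} (hf : Continuous f) {κ c : ℝ}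
    (hκ : κ < 1) (hc : 0 < c) (hL : MonotoneOn L (Set.Ici 1)) (hL1 : ∀ᶠ R in atTop, 1 ≤ L R)
    (h : ∀ᶠ R in atTop, c * (R ^ (1 - κ) * L R) ≤ ∫ l in (0 : ℝ)..R, f l) :
    ∃ ε : ℝ, 0 < ε ∧ ∃ᶠ l in atTop, ε * (l ^ (-κ) * L l) ≤ f l := by
  have hκ' : 0 < 1 - κ := by linarith
  -- Since `∫ l ^ (-κ)` is at most `R ^ (1 - κ) / (1 - κ)`, this `ε` lets the range beyond `l₀`
  -- account for only half of the assumed lower bound. The other half outgrows the fixed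
  -- contribution `K` of `[0, l₀]`.
  refine ⟨c * (1 - κ) / 2, by positivity, fun hcon => ?_⟩
  obtain ⟨l₀, hl₀⟩ := eventually_atTop.1 (hcon.and (hL1.and (eventually_ge_atTop 1)))
  have hl₀1 : 1 ≤ l₀ := (hl₀ l₀ le_rfl).2.2
  set K := ∫ l in (0 : ℝ)..l₀, f l
  have htend : Tendsto (fun R : ℝ => R ^ (1 - κ)) atTop atTop := tendsto_rpow_atTop hκ'
  obtain ⟨R, hRl, hR, hRK⟩ := ((eventually_ge_atTop l₀).and
    (h.and (htend.eventually_gt_atTop (2 * K / c)))).exists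
  have hR1 : 1 ≤ R := hl₀1.trans hRl
  have hR0 : 0 < R := by linarith
  have hLR : 1 ≤ L R := (hl₀ R hRl).2.1
  have hpow : IntervalIntegrable (fun l : ℝ => l ^ (-κ)) volume l₀ R :=
    intervalIntegral.intervalIntegrable_rpow (Or.inr (by
      rw [Set.uIcc_of_le hRl]; exact fun h => by linarith [h.1]))
  have h1 : ∫ l in l₀..R, f l ≤ ∫ l in l₀..R, (c * (1 - κ) / 2 * L R) * l ^ (-κ) := by
    refine intervalIntegral.integral_mono_on hRl (hf.intervalIntegrable _ _)
      (hpow.const_mul _) fun l hl => ?_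
    have h2 := (hl₀ l hl.1).1
    rw [not_le] at h2
    have hl1 : 1 ≤ l := hl₀1.trans hl.1
    have h3 : L l ≤ L R := hL hl1 hR1 hl.2
    have h4 : 0 ≤ l ^ (-κ) := Real.rpow_nonneg (by linarith) _
    calc f l ≤ c * (1 - κ) / 2 * (l ^ (-κ) * L l) := h2.le
      _ ≤ c * (1 - κ) / 2 * (l ^ (-κ) * L R) := by gcongr
      _ = _ := by ring
  have h5 : ∫ l in l₀..R, l ^ (-κ) ≤ R ^ (1 - κ) / (1 - κ) := by
    rw [integral_rpow (Or.inl (by linarith)), show -κ + 1 = 1 - κ by ring]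
    gcongr
    linarith [Real.rpow_nonneg (show 0 ≤ l₀ by linarith) (1 - κ)]
  rw [intervalIntegral.integral_const_mul] at h1
  rw [← intervalIntegral.integral_add_adjacent_intervals (hf.intervalIntegrable 0 l₀)
    (hf.intervalIntegrable l₀ R)] at hR
  have h6 : c * (1 - κ) / 2 * L R * ∫ l in l₀..R, l ^ (-κ)
      ≤ c / 2 * (R ^ (1 - κ) * L R) := by
    calc _ ≤ c * (1 - κ) / 2 * L R * (R ^ (1 - κ) / (1 - κ)) := by gcongr
      _ = _ := by field_simp
  have h7 : R ^ (1 - κ) * 1 ≤ R ^ (1 - κ) * L R := by gcongr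
  rw [div_lt_iff₀ hc] at hRK
  change c * (R ^ (1 - κ) * L R) ≤ K + _ at hR
  nlinarith

/-! ### Supporting lines of the Newton polygon on the bisectrix. -/

section NewtonPolygon

variable {S : ℝ × ℝ → ℝ}

theorem mem_newtonPolygon {a b : ℕ} (h : taylorCoeff₂ S a b ≠ 0) {x y : ℝ} (hx : (a : ℝ) ≤ x)
    (hy : (b : ℝ) ≤ y) : (x, y) ∈ newtonPolygon S :=
  subset_convexHull ℝ _ ⟨a, b, h, hx, hy⟩

theorem add_mem_newtonPolygon {p q : ℝ × ℝ} (hp : p ∈ newtonPolygon S) (h1 : 0 ≤ q.1)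
    (h2 : 0 ≤ q.2) : q + p ∈ newtonPolygon S := by
  have hc : Convex ℝ ((fun z => q + z) ⁻¹' newtonPolygon S) :=
    (convex_convexHull ℝ _).translate_preimage_right q
  refine convexHull_min ?_ hc hp
  rintro ⟨x, y⟩ ⟨a, b, h, hx, hy⟩
  exact mem_newtonPolygon h (by simp at hx ⊢; linarith) (by simp at hy ⊢; linarith)

theorem nonneg_of_mem_newtonPolygon {p : ℝ × ℝ} (hp : p ∈ newtonPolygon S) :
    p ∈ Set.Ici (0 : ℝ × ℝ) := by
  refine convexHull_min ?_ (convex_Ici 0) hp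
  rintro ⟨x, y⟩ ⟨a, b, -, hx, hy⟩
  exact ⟨(Nat.cast_nonneg a).trans hx, (Nat.cast_nonneg b).trans hy⟩

theorem newtonDistance_le {t : ℝ} (ht : (t, t) ∈ newtonPolygon S) : newtonDistance S ≤ t :=
  csInf_le ⟨0, fun _ hs => (nonneg_of_mem_newtonPolygon hs).1⟩ ht

/-- The weights of an edge meeting the bisectrix. -/
theorem IsNewtonEdge.exists_weights {e : Set (ℝ × ℝ)} (he : IsNewtonEdge S e)
    (hb : (e ∩ bisectrix).Nonempty) (hd : 0 < newtonDistance S) :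
    ∃ p q : ℝ, 0 ≤ p ∧ 0 ≤ q ∧ p + q = 1 / newtonDistance S ∧
      (∀ a b, taylorCoeff₂ S a b ≠ 0 → 1 ≤ a * p + b * q) ∧ (IsCompact e → 0 < p ∧ 0 < q) := by
  obtain ⟨-, u, v, c, huv, hmin, rfl⟩ := he
  obtain ⟨⟨t, t'⟩, ⟨hN, hc⟩, ht⟩ := hb
  obtain rfl : t = t' := ht
  simp only at hc
  -- The polygon is stable under translation by the positive quadrant, so a functional bounded below
  -- on it has nonnegative coefficients.
  have hu : 0 ≤ u := by
    have := hmin _ (add_mem_newtonPolygon (q := (1, 0)) hN (by simp) (by simp))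
    simp at this
    linarith
  have hv : 0 ≤ v := by
    have := hmin _ (add_mem_newtonPolygon (q := (0, 1)) hN (by simp) (by simp))
    simp at this
    linarith
  have huv0 : 0 < u + v := by
    rcases hu.lt_or_eq with h | h
    · linarith
    · rcases hv.lt_or_eq with h' | h'
      · linarith
      · exact absurd (by rw [← h, ← h']) huv
  have hdt : newtonDistance S = t := by
    refine le_antisymm (newtonDistance_le hN) (le_csInf ⟨t, hN⟩ fun s hs => ?_)
    have := hmin _ hs
    simp only at this
    exact le_of_mul_le_mul_left (by linarith) huv0
  rw [hdt] at hd ⊢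
  have hc0 : 0 < c := by nlinarith
  refine ⟨u / c, v / c, by positivity, by positivity, ?_, fun a b h => ?_, fun hcomp => ?_⟩
  · rw [← add_div, div_eq_div_iff hc0.ne' hd.ne']
    linarith
  · have := hmin _ (mem_newtonPolygon h le_rfl le_rfl)
    rw [mul_div, mul_div, ← add_div, le_div_iff₀ hc0]
    simp only at this
    linarith
  -- A vanishing weight would put a whole horizontal or vertical ray from `(t, t)` into the edge.
  · obtain ⟨B, hB⟩ := hcomp.isBounded.exists_norm_le
    have hB0 : 0 ≤ B := (norm_nonneg _).trans (hB (t, t) ⟨hN, hc⟩)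
    constructor
    · refine div_pos (hu.lt_of_ne fun h => ?_) hc0
      have := hB ((B + 1, 0) + (t, t))
        ⟨add_mem_newtonPolygon hN (by simp; linarith) (by simp), by
          simp [← h] at hc ⊢; linarith⟩
      have h2 := (norm_fst_le _).trans this
      simp only [Prod.fst_add, Real.norm_eq_abs] at h2
      linarith [le_abs_self (B + 1 + t)]
    · refine div_pos (hv.lt_of_ne fun h => ?_) hc0
      have := hB ((0, B + 1) + (t, t))
        ⟨add_mem_newtonPolygon hN (by simp) (by simp; linarith), by
          simp [← h] at hc ⊢; linarith⟩
      have h2 := (norm_snd_le _).trans this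
      simp only [Prod.snd_add, Real.norm_eq_abs] at h2
      linarith [le_abs_self (B + 1 + t)]

/-- Dickson's lemma in the plane. -/
theorem exists_finset_dominating (s : Set (ℕ × ℕ)) :
    ∃ F : Finset (ℕ × ℕ), (∀ p ∈ F, p ∈ s) ∧ ∀ p ∈ s, ∃ q ∈ F, q ≤ p := by
  have hfin : {p | Minimal (· ∈ s) p}.Finite :=
    WellQuasiOrderedLE.finite_of_isAntichain (setOfPred_minimal_antichain _)
  refine ⟨hfin.toFinset, fun p hp => ((hfin.mem_toFinset).1 hp).1, fun p hp => ?_⟩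
  obtain ⟨q, hqp, hq⟩ := (Set.isPWO_of_wellQuasiOrderedLE s).exists_le_minimal hp
  exact ⟨q, hfin.mem_toFinset.2 hq, hqp⟩

/-- If `(d, d)` is a vertex of the Newton polygon then an open cone of weights supports the polygon
at `(d, d)`. -/
theorem NewtonCase2.exists_slopes (h : NewtonCase2 S) :
    ∃ m M : ℝ, 0 < m ∧ m < M ∧ ∀ a b, taylorCoeff₂ S a b ≠ 0 →
      newtonDistance S * (1 + m) ≤ a + b * m ∧ newtonDistance S * (1 + M) ≤ a + b * M := by
  classical
  set d := newtonDistance S with hd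
  have hext := mem_extremePoints.1 h
  -- Otherwise `(d, d)` is the midpoint of a nondegenerate horizontal segment in the polygon.
  have hleft : ∀ a b : ℕ, taylorCoeff₂ S a b ≠ 0 → (a : ℝ) < d → d < b := by
    intro a b hab ha
    by_contra! hb
    have h1 : ((a : ℝ), d) ∈ newtonPolygon S := mem_newtonPolygon hab le_rfl hb
    have h2 : (2 * d - a, d) ∈ newtonPolygon S := mem_newtonPolygon hab (by linarith) hb
    have h3 := (hext.2 _ h1 _ h2 ⟨1 / 2, 1 / 2, by norm_num, by norm_num, by norm_num, by
      ext <;> simp <;> ring⟩).1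
    simp only [Prod.mk.injEq] at h3
    linarith [h3.1]
  have hright : ∀ a b : ℕ, taylorCoeff₂ S a b ≠ 0 → (b : ℝ) < d → d < a := by
    intro a b hab hb
    by_contra! ha
    have h1 : (d, (b : ℝ)) ∈ newtonPolygon S := mem_newtonPolygon hab ha le_rfl
    have h2 : (d, 2 * d - b) ∈ newtonPolygon S := mem_newtonPolygon hab ha (by linarith)
    have h3 := (hext.2 _ h1 _ h2 ⟨1 / 2, 1 / 2, by norm_num, by norm_num, by norm_num, by
      ext <;> simp <;> ring⟩).1
    simp only [Prod.mk.injEq] at h3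
    linarith [h3.2]
  -- If this fails, the segment from `(a, b)` to `(a', b')` passes through or below `(d, d)`; moved
  -- up by `d - y`, it stays in the polygon and has `(d, d)` in its interior.
  have hcross : ∀ a b a' b' : ℕ, taylorCoeff₂ S a b ≠ 0 → taylorCoeff₂ S a' b' ≠ 0 →
      (a : ℝ) < d → (b' : ℝ) < d → (d - a) / (b - d) < (a' - d) / (d - b') := by
    intro a b a' b' hab hab' ha hb'
    have hb := hleft a b hab ha
    have ha' := hright a' b' hab' hb'
    by_contra! hcon
    rw [div_le_div_iff₀ (by linarith) (by linarith)] at hcon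
    have hw : 0 < (a' : ℝ) - a := by linarith
    set θ : ℝ := (a' - d) / (a' - a) with hθ
    have hθ0 : 0 < θ := div_pos (by linarith) hw
    have hθ1 : 1 - θ = (d - a) / (a' - a) := by rw [hθ]; field_simp; ring
    have hθ1' : 0 < 1 - θ := by rw [hθ1]; exact div_pos (by linarith) hw
    set y : ℝ := θ * b + (1 - θ) * b' with hy
    have hyd : y ≤ d := by
      rw [hy, hθ1, hθ, div_mul_eq_mul_div, div_mul_eq_mul_div, ← add_div, div_le_iff₀ hw]
      linarith
    have h1 : ((a : ℝ), b + (d - y)) ∈ newtonPolygon S :=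
      mem_newtonPolygon hab le_rfl (by linarith)
    have h2 : ((a' : ℝ), b' + (d - y)) ∈ newtonPolygon S :=
      mem_newtonPolygon hab' le_rfl (by linarith)
    have hx : θ * a + (1 - θ) * a' = d := by
      rw [hθ1, hθ]; field_simp; ring
    have h3 := (hext.2 _ h1 _ h2 ⟨θ, 1 - θ, hθ0, hθ1', by ring, by
      ext
      · simpa using hx
      · simp only [Prod.smul_mk, Prod.mk_add_mk, smul_eq_mul]
        linarith⟩).1
    simp only [Prod.mk.injEq] at h3
    linarith [h3.1]
  obtain ⟨F, hFs, hF⟩ := exists_finset_dominating {p : ℕ × ℕ | taylorCoeff₂ S p.1 p.2 ≠ 0}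
  -- The condition `d * (1 + μ) ≤ a + b * μ` is a lower bound on `μ` when `a < d` and an upper bound
  -- when `b < d`. Dickson's lemma leaves finitely many bounds, so strict separation leaves room for
  -- two slopes; the element `0` forces them to be positive.
  let lo : Finset ℝ := insert 0 ((F.filter fun p => (p.1 : ℝ) < d).image
    fun p => (d - p.1) / (p.2 - d))
  let hi : Finset ℝ := (F.filter fun p => (p.2 : ℝ) < d).image fun p => (p.1 - d) / (d - p.2)
  have hlohi : ∀ x ∈ lo, ∀ y ∈ hi, x < y := by
    intro x hx y hy
    obtain ⟨q, hq, rfl⟩ := Finset.mem_image.1 hy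
    obtain ⟨hqF, hqd⟩ := Finset.mem_filter.1 hq
    rcases Finset.mem_insert.1 hx with rfl | hx
    · have := hright _ _ (hFs q hqF) hqd
      exact div_pos (by linarith) (by linarith)
    · obtain ⟨p, hp, rfl⟩ := Finset.mem_image.1 hx
      obtain ⟨hpF, hpd⟩ := Finset.mem_filter.1 hp
      exact hcross _ _ _ _ (hFs p hpF) (hFs q hqF) hpd hqd
  obtain ⟨m, hm, hm'⟩ := Order.exists_between_finsets lo hi hlohi
  obtain ⟨M, hM, hM'⟩ := Order.exists_between_finsets (insert m lo) hi (by
    intro x hx y hy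
    rcases Finset.mem_insert.1 hx with rfl | hx
    · exact hm' y hy
    · exact hlohi x hx y hy)
  have hm0 : 0 < m := hm 0 (Finset.mem_insert_self _ _)
  have hmM : m < M := hM m (Finset.mem_insert_self _ _)
  have key : ∀ μ : ℝ, 0 < μ → (∀ x ∈ lo, x < μ) → (∀ y ∈ hi, μ < y) → ∀ a b : ℕ,
      taylorCoeff₂ S a b ≠ 0 → d * (1 + μ) ≤ a + b * μ := by
    intro μ hμ hlo hhi a b hab
    obtain ⟨q, hqF, hq⟩ := hF (a, b) hab
    have hq1 : (q.1 : ℝ) ≤ a := by exact_mod_cast hq.1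
    have hq2 : (q.2 : ℝ) ≤ b := by exact_mod_cast hq.2
    suffices d * (1 + μ) ≤ q.1 + q.2 * μ by nlinarith
    rcases lt_or_ge (q.1 : ℝ) d with h1 | h1
    · have h2 := hleft _ _ (hFs q hqF) h1
      have h3 := hlo _ (Finset.mem_insert_of_mem
        (Finset.mem_image_of_mem _ (Finset.mem_filter.2 ⟨hqF, h1⟩)))
      rw [div_lt_iff₀ (by linarith)] at h3
      linarith
    · rcases lt_or_ge (q.2 : ℝ) d with h2 | h2
      · have h3 := hhi _ (Finset.mem_image_of_mem _ (Finset.mem_filter.2 ⟨hqF, h2⟩))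
        rw [lt_div_iff₀ (by linarith)] at h3
        linarith
      · nlinarith
  refine ⟨m, M, hm0, hmM, fun a b hab => ⟨key m hm0 hm hm' a b hab,
    key M (hm0.trans hmM) (fun x hx => hM x (Finset.mem_insert_of_mem hx)) hM' a b hab⟩⟩

end NewtonPolygon

/-! ### Lower bounds for the area of sublevel sets. -/

/-- The sublevel sets `|S| ≤ t` near the origin have area at least of order `t ^ κ * L (1 / t)`. -/
def SublevelGrowth (S : ℝ × ℝ → ℝ) (κ : ℝ) (L : ℝ → ℝ) : Prop :=
  ∃ C c : ℝ, 0 < C ∧ 0 < c ∧ ∀ ρ : ℝ, 0 < ρ → ∀ᶠ t in nhdsWithin (0 : ℝ) (Set.Ioi 0),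
    ∃ A : Set (ℝ × ℝ), MeasurableSet A ∧ A ⊆ Metric.closedBall 0 ρ ∧ (∀ p ∈ A, |S p| ≤ C * t) ∧
      c * (t ^ κ * L (1 / t)) ≤ volume.real A

section Growth

variable {U : Set (ℝ × ℝ)} {S : ℝ × ℝ → ℝ}

theorem mem_closedBall_zero_of_nonneg {x y ρ : ℝ} (hx : 0 ≤ x) (hxρ : x ≤ ρ) (hy : 0 ≤ y)
    (hyρ : y ≤ ρ) : (x, y) ∈ Metric.closedBall (0 : ℝ × ℝ) ρ := by
  rw [mem_closedBall_zero_iff, Prod.norm_def]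
  simp only [Real.norm_eq_abs, abs_of_nonneg hx, abs_of_nonneg hy]
  exact max_le hxρ hyρ

theorem tendsto_rpow_nhdsGT_zero {p : ℝ} (hp : 0 < p) :
    Tendsto (fun t : ℝ => t ^ p) (nhdsWithin 0 (Set.Ioi 0)) (nhdsWithin 0 (Set.Ioi 0)) := by
  refine tendsto_nhdsWithin_iff.2 ⟨?_, ?_⟩
  · have := (Real.continuousAt_rpow_const 0 p (Or.inr hp.le)).tendsto
    rw [Real.zero_rpow hp.ne'] at this
    exact this.mono_left nhdsWithin_le_nhds
  · filter_upwards [self_mem_nhdsWithin] with t ht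
    exact Real.rpow_pos_of_pos ht p

/-- Boxes adapted to strictly positive weights lie in sublevel sets. -/
theorem sublevelGrowth_of_weights (hU : IsOpen U) (h0U : (0 : ℝ × ℝ) ∈ U)
    (hS : ContDiffOn ℝ ∞ S U) {p q : ℝ} (hp : 0 < p) (hq : 0 < q)
    (h : ∀ a b, taylorCoeff₂ S a b ≠ 0 → 1 ≤ a * p + b * q) :
    SublevelGrowth S (p + q) fun _ => 1 := by
  -- With this `n` the remainder powers `x ^ (n + 1)` and `y ^ (n + 1)` satisfy the same weight
  -- inequality as the Taylor monomials.
  obtain ⟨n, hn⟩ := exists_nat_ge (max (1 / p) (1 / q))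
  have hnp : 1 ≤ ((n + 1 : ℕ) : ℝ) * p := by
    have := (le_max_left _ _).trans hn
    rw [div_le_iff₀ hp] at this
    push_cast; nlinarith
  have hnq : 1 ≤ ((n + 1 : ℕ) : ℝ) * q := by
    have := (le_max_right _ _).trans hn
    rw [div_le_iff₀ hq] at this
    push_cast; nlinarith
  obtain ⟨C, r, hC, hr, hmaj⟩ := exists_abs_le_of_monomial_le hU h0U hS n
  refine ⟨C, 1, hC, one_pos, fun ρ hρ => ?_⟩
  have hsmall : ∀ᶠ s in nhdsWithin (0 : ℝ) (Set.Ioi 0), s ≤ min r ρ :=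
    mem_nhdsWithin_of_mem_nhds (Iic_mem_nhds (lt_min hr hρ))
  filter_upwards [self_mem_nhdsWithin, (tendsto_rpow_nhdsGT_zero hp).eventually hsmall,
    (tendsto_rpow_nhdsGT_zero hq).eventually hsmall,
    mem_nhdsWithin_of_mem_nhds (Iic_mem_nhds one_pos)] with t ht htp htq ht1
  rw [Set.mem_Ioi] at ht
  rw [Set.mem_Iic] at ht1
  have hmon : ∀ a b : ℕ, 1 ≤ a * p + b * q → ∀ x y : ℝ, 0 ≤ x → x ≤ t ^ p → 0 ≤ y → y ≤ t ^ q →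
      x ^ a * y ^ b ≤ t := by
    intro a b hab x y hx hxt hy hyt
    calc x ^ a * y ^ b ≤ (t ^ p) ^ a * (t ^ q) ^ b := by gcongr
      _ = t ^ (a * p + b * q) := by
        rw [← Real.rpow_mul_natCast ht.le, ← Real.rpow_mul_natCast ht.le, ← Real.rpow_add ht]
        ring_nf
      _ ≤ t ^ (1 : ℝ) := Real.rpow_le_rpow_of_exponent_ge ht ht1 hab
      _ = t := Real.rpow_one t
  refine ⟨Set.Icc 0 (t ^ p) ×ˢ Set.Icc 0 (t ^ q), measurableSet_Icc.prod measurableSet_Icc,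
    ?_, ?_, ?_⟩
  · rintro ⟨x, y⟩ ⟨hx, hy⟩
    exact mem_closedBall_zero_of_nonneg hx.1 (hx.2.trans (htp.trans (min_le_right _ _))) hy.1
      (hy.2.trans (htq.trans (min_le_right _ _)))
  · rintro ⟨x, y⟩ ⟨hx, hy⟩
    refine hmaj x y t hx.1 (hx.2.trans (htp.trans (min_le_left _ _))) hy.1
      (hy.2.trans (htq.trans (min_le_left _ _)))
      (fun a b hab => hmon a b (h a b hab) x y hx.1 hx.2 hy.1 hy.2) ?_ ?_
    · simpa using hmon (n + 1) 0 (by simpa using hnp) x y hx.1 hx.2 hy.1 hy.2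
    · simpa using hmon 0 (n + 1) (by simpa using hnq) x y hx.1 hx.2 hy.1 hy.2
  · rw [Measure.volume_eq_prod, measureReal_prod_prod, Real.volume_real_Icc_of_le (by positivity),
      Real.volume_real_Icc_of_le (by positivity), Real.rpow_add ht]
    simp

/-- In logarithms the claim is `(a - d) X + (b - d) Y ≤ 0` for `M X ≤ Y ≤ m X` and `X ≤ 0`. It is
linear in `Y`, so one endpoint decides, according to the sign of `b - d`. -/
theorem pow_mul_pow_le_rpow {x y m M d : ℝ} (hx : 0 < x) (hx1 : x ≤ 1) (hy : 0 < y)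
    (hyM : x ^ M ≤ y) (hym : y ≤ x ^ m) {a b : ℕ} (h1 : d * (1 + m) ≤ a + b * m)
    (h2 : d * (1 + M) ≤ a + b * M) : x ^ a * y ^ b ≤ (x * y) ^ d := by
  have hX : Real.log x ≤ 0 := Real.log_nonpos hx.le hx1
  have hM := Real.log_le_log (Real.rpow_pos_of_pos hx M) hyM
  have hm := Real.log_le_log hy hym
  rw [Real.log_rpow hx] at hM hm
  rw [← Real.log_le_log_iff (by positivity) (by positivity), Real.log_mul (by positivity)
    (by positivity), Real.log_pow, Real.log_pow, Real.log_rpow (by positivity),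
    Real.log_mul hx.ne' hy.ne']
  rcases le_total d b with hb | hb
  · nlinarith [mul_le_mul_of_nonneg_left hm (sub_nonneg.2 hb),
      mul_nonneg (sub_nonneg.2 h1) (neg_nonneg.2 hX)]
  · nlinarith [mul_le_mul_of_nonneg_left hM (sub_nonneg.2 hb),
      mul_nonneg (sub_nonneg.2 h2) (neg_nonneg.2 hX)]

theorem volume_real_regionBetween_hyperbolas {s α β : ℝ} (hs : 0 < s) (hα : 0 < α) (hαβ : α ≤ β) :
    volume.real (regionBetween (fun x => s / (2 * x)) (fun x => s / x) (Set.Icc α β))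
      = s / 2 * (Real.log β - Real.log α) := by
  have hne : ∀ x ∈ Set.Icc α β, x ≠ 0 := fun x hx => (hα.trans_le hx.1).ne'
  have hint : ∫ y in Set.Icc α β, ((fun x => s / x) - fun x => s / (2 * x)) y
      = s / 2 * (Real.log β - Real.log α) := by
    rw [← Real.log_div (hα.trans_le hαβ).ne' hα.ne', ← integral_inv_of_pos hα (hα.trans_le hαβ),
      ← intervalIntegral.integral_const_mul, intervalIntegral.integral_of_le hαβ,
      ← integral_Icc_eq_integral_Ioc]
    refine setIntegral_congr_fun measurableSet_Icc fun x hx => ?_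
    have := hne x hx
    simp only [Pi.sub_apply]
    field_simp
    norm_num
  rw [Measure.real, Measure.volume_eq_prod, volume_regionBetween_eq_integral _ _ measurableSet_Icc,
    hint, ENNReal.toReal_ofReal]
  · exact mul_nonneg (by positivity) (sub_nonneg.2 (Real.log_le_log hα hαβ))
  · intro x hx
    have := hα.trans_le hx.1
    exact div_le_div_of_nonneg_left hs.le this (by linarith)
  · exact (ContinuousOn.div continuousOn_const (by fun_prop)
      fun x hx => mul_ne_zero two_ne_zero (hne x hx)).integrableOn_Icc
  · exact (ContinuousOn.div continuousOn_const (by fun_prop) hne).integrableOn_Icc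

/-- At a vertex on the bisectrix the hyperbolic regions inside the supporting cone contribute an
extra logarithm. -/
theorem sublevelGrowth_of_slopes (hU : IsOpen U) (h0U : (0 : ℝ × ℝ) ∈ U)
    (hS : ContDiffOn ℝ ∞ S U) {d m M : ℝ} (hd : 0 < d) (hm : 0 < m) (hmM : m < M)
    (h : ∀ a b, taylorCoeff₂ S a b ≠ 0 → d * (1 + m) ≤ a + b * m ∧ d * (1 + M) ≤ a + b * M) :
    SublevelGrowth S (1 / d) Real.log := by
  have hM : 0 < M := hm.trans hmM
  obtain ⟨n, hn⟩ := exists_nat_ge (max (d * (1 + M)) (d * (1 + m) / m))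
  have hn1 : d * (1 + M) ≤ ((n + 1 : ℕ) : ℝ) := by
    have := (le_max_left _ _).trans hn
    push_cast; linarith
  have hn2 : d * (1 + m) ≤ ((n + 1 : ℕ) : ℝ) * m := by
    have := (le_max_right _ _).trans hn
    rw [div_le_iff₀ hm] at this
    push_cast; nlinarith
  have hn3 : d * (1 + m) ≤ ((n + 1 : ℕ) : ℝ) := by nlinarith
  have hn4 : d * (1 + M) ≤ ((n + 1 : ℕ) : ℝ) * M := by
    have : d ≤ ((n + 1 : ℕ) : ℝ) := by nlinarith
    nlinarith
  obtain ⟨C, r, hC, hr, hmaj⟩ := exists_abs_le_of_monomial_le hU h0U hS n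
  -- The interval `[α, β]` chosen below has logarithmic length `γ * -log s` up to a constant.
  set γ : ℝ := 1 / (1 + m) - 1 / (1 + M) with hγdef
  have hγ : 0 < γ := sub_pos.2 (one_div_lt_one_div_of_lt (by linarith) (by linarith))
  refine ⟨C, γ / (4 * d), hC, by positivity, fun ρ hρ => ?_⟩
  have hρ' : 0 < min 1 (min r ρ) := lt_min one_pos (lt_min hr hρ)
  have hsT := tendsto_rpow_nhdsGT_zero (p := 1 / d) (by positivity)
  have hhalf : Tendsto (fun s : ℝ => s / 2) (nhdsWithin 0 (Set.Ioi 0))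
      (nhdsWithin 0 (Set.Ioi 0)) := by
    refine tendsto_nhdsWithin_iff.2 ⟨?_, ?_⟩
    · have : Tendsto (fun s : ℝ => s / 2) (nhds 0) (nhds (0 / 2)) := tendsto_id.div_const 2
      rw [zero_div] at this
      exact this.mono_left nhdsWithin_le_nhds
    · filter_upwards [self_mem_nhdsWithin] with t ht
      exact half_pos (Set.mem_Ioi.1 ht)
  have hβT := (tendsto_rpow_nhdsGT_zero (p := 1 / (1 + M)) (by positivity)).comp hhalf
  have hβmT := (tendsto_rpow_nhdsGT_zero hm).comp hβT
  have hsmall : ∀ᶠ s in nhdsWithin (0 : ℝ) (Set.Ioi 0), s ≤ min 1 (min r ρ) :=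
    mem_nhdsWithin_of_mem_nhds (Iic_mem_nhds hρ')
  -- Makes the constant `log 2 / (1 + M)` at most half of the main term `γ * -log s`.
  have hlog : ∀ᶠ s in nhdsWithin (0 : ℝ) (Set.Ioi 0),
      Real.log s ≤ -(2 / γ * (Real.log 2 / (1 + M))) :=
    Real.tendsto_log_nhdsGT_zero.eventually_le_atBot _
  filter_upwards [self_mem_nhdsWithin, hsT.eventually (hβT.eventually hsmall),
    hsT.eventually (hβmT.eventually hsmall), hsT.eventually hlog] with t ht hβ hβm hlogs
  rw [Set.mem_Ioi] at ht
  simp only [Function.comp_apply] at hβ hβm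
  set s : ℝ := t ^ (1 / d) with hsdef
  have hs : 0 < s := Real.rpow_pos_of_pos ht _
  -- At `x = β` the lower hyperbola `y = s / (2 x)` meets `y = x ^ M`; at `x = α` the upper one `y =
  -- s / x` meets `y = x ^ m`. Between them the region stays inside the cone.
  set β : ℝ := (s / 2) ^ (1 / (1 + M)) with hβdef
  set α : ℝ := s ^ (1 / (1 + m)) with hαdef
  have hβ0 : 0 < β := Real.rpow_pos_of_pos (by positivity) _
  have hα0 : 0 < α := Real.rpow_pos_of_pos hs _
  have hlogdiff : γ / 2 * -Real.log s ≤ Real.log β - Real.log α := by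
    rw [hβdef, hαdef, Real.log_rpow (half_pos hs), Real.log_rpow hs,
      Real.log_div hs.ne' two_ne_zero]
    have h1 : Real.log 2 / (1 + M) ≤ γ / 2 * -Real.log s := by
      have := mul_le_mul_of_nonneg_left (le_neg.2 hlogs) (show 0 ≤ γ / 2 by positivity)
      calc Real.log 2 / (1 + M) = γ / 2 * (2 / γ * (Real.log 2 / (1 + M))) := by field_simp
        _ ≤ _ := this
    have h2 : 1 / (1 + M) * (Real.log s - Real.log 2) - 1 / (1 + m) * Real.log s
        = γ * -Real.log s - Real.log 2 / (1 + M) := by rw [hγdef]; ring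
    rw [h2]
    linarith
  have hlogs0 : 0 ≤ -Real.log s := by
    have : 0 ≤ 2 / γ * (Real.log 2 / (1 + M)) :=
      mul_nonneg (by positivity) (div_nonneg (Real.log_nonneg one_le_two) (by linarith))
    linarith
  have hαβ : α ≤ β := by
    rw [← Real.log_le_log_iff hα0 hβ0]
    nlinarith [mul_nonneg (show 0 ≤ γ / 2 by positivity) hlogs0]
  have hpt : ∀ x y : ℝ, x ∈ Set.Icc α β → s / (2 * x) < y → y < s / x →
      0 < x ∧ 0 < y ∧ x ^ M ≤ y ∧ y ≤ x ^ m := by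
    intro x y hx hy1 hy2
    have hx0 : 0 < x := hα0.trans_le hx.1
    refine ⟨hx0, lt_trans (by positivity) hy1, le_trans ?_ hy1.le, hy2.le.trans ?_⟩
    · have h1 : x ^ (1 + M) ≤ s / 2 := by
        calc x ^ (1 + M) ≤ β ^ (1 + M) := Real.rpow_le_rpow hx0.le hx.2 (by linarith)
          _ = s / 2 := by
            rw [hβdef, ← Real.rpow_mul (by positivity), one_div_mul_cancel (by positivity),
              Real.rpow_one]
      rw [Real.rpow_add hx0, Real.rpow_one] at h1
      rw [le_div_iff₀ (by positivity)]
      linarith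
    · have h1 : s ≤ x ^ (1 + m) := by
        calc s = α ^ (1 + m) := by
              rw [hαdef, ← Real.rpow_mul hs.le, one_div_mul_cancel (by positivity), Real.rpow_one]
          _ ≤ x ^ (1 + m) := Real.rpow_le_rpow hα0.le hx.1 (by linarith)
      rw [Real.rpow_add hx0, Real.rpow_one] at h1
      rw [div_le_iff₀ hx0]
      linarith
  have hxs : ∀ x ∈ Set.Icc α β, x ≤ min 1 (min r ρ) := fun x hx => hx.2.trans hβ
  have hys : ∀ x ∈ Set.Icc α β, x ^ m ≤ min 1 (min r ρ) := fun x hx =>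
    (Real.rpow_le_rpow (hα0.le.trans hx.1) hx.2 hm.le).trans hβm
  refine ⟨regionBetween (fun x => s / (2 * x)) (fun x => s / x) (Set.Icc α β),
    measurableSet_regionBetween (by fun_prop) (by fun_prop) measurableSet_Icc, ?_, ?_, ?_⟩
  · rintro ⟨x, y⟩ ⟨hx, hy1, hy2⟩
    obtain ⟨hx0, hy0, -, hym⟩ := hpt x y hx hy1 hy2
    have h1 : min 1 (min r ρ) ≤ ρ := (min_le_right _ _).trans (min_le_right _ _)
    exact mem_closedBall_zero_of_nonneg hx0.le ((hxs x hx).trans h1) hy0.le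
      (hym.trans ((hys x hx).trans h1))
  · rintro ⟨x, y⟩ ⟨hx, hy1, hy2⟩
    obtain ⟨hx0, hy0, hyM, hym⟩ := hpt x y hx hy1 hy2
    have h1 : min 1 (min r ρ) ≤ r := (min_le_right _ _).trans (min_le_left _ _)
    have hx1 : x ≤ 1 := (hxs x hx).trans (min_le_left _ _)
    have hxy : (x * y) ^ d ≤ t := by
      calc (x * y) ^ d ≤ s ^ d := by
            refine Real.rpow_le_rpow (by positivity) ?_ hd.le
            have := (lt_div_iff₀ hx0).1 hy2
            linarith
        _ = t := by
            rw [hsdef, ← Real.rpow_mul ht.le, one_div_mul_cancel hd.ne', Real.rpow_one]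
    have hmon : ∀ a b : ℕ, d * (1 + m) ≤ a + b * m → d * (1 + M) ≤ a + b * M →
        x ^ a * y ^ b ≤ t := fun a b h1 h2 =>
      (pow_mul_pow_le_rpow hx0 hx1 hy0 hyM hym h1 h2).trans hxy
    refine hmaj x y t hx0.le ((hxs x hx).trans h1) hy0.le (hym.trans ((hys x hx).trans h1))
      (fun a b hab => hmon a b (h a b hab).1 (h a b hab).2) ?_ ?_
    · simpa using hmon (n + 1) 0 (by simpa using hn3) (by simpa using hn1)
    · simpa using hmon 0 (n + 1) (by simpa using hn2) (by simpa using hn4)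
  · rw [volume_real_regionBetween_hyperbolas hs hα0 hαβ]
    have h1 : Real.log (1 / t) = d * -Real.log s := by
      rw [hsdef, Real.log_rpow ht, one_div, Real.log_inv]
      field_simp
    rw [h1]
    calc γ / (4 * d) * (s * (d * -Real.log s)) = s / 2 * (γ / 2 * -Real.log s) := by
          field_simp; ring
      _ ≤ _ := mul_le_mul_of_nonneg_left hlogdiff (by positivity)

end Growth

/-! ### From sublevel sets to the limsup bounds. -/

theorem oscIntegral_congr_of_support {S T φ : ℝ × ℝ → ℝ} (h : ∀ p, φ p ≠ 0 → S p = T p) :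
    oscIntegral S φ = oscIntegral T φ := by
  funext l
  refine integral_congr_ae (Eventually.of_forall fun p => ?_)
  by_cases hp : φ p = 0
  · simp [hp]
  · simp only [h p hp]

/-- Lower bounds for sublevel sets yield lower bounds for the oscillatory integral along a sequence
of frequencies. -/
theorem SublevelGrowth.exists_frequently_le_norm_oscIntegral {U : Set (ℝ × ℝ)} (hU : IsOpen U)
    {S φ : ℝ × ℝ → ℝ} (hS : ContinuousOn S U) (hφ : Continuous φ) (hφc : HasCompactSupport φ)
    (hφU : tsupport φ ⊆ U) (hφ_nonneg : ∀ p, 0 ≤ φ p) (hφ0 : 0 < φ 0) {κ : ℝ} {L : ℝ → ℝ}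
    (hκ : κ < 1) (hL : MonotoneOn L (Set.Ici 1)) (hL1 : ∀ᶠ R in atTop, 1 ≤ L R)
    (h : SublevelGrowth S κ L) :
    ∃ ε : ℝ, 0 < ε ∧ ∃ᶠ l in atTop, ε * (l ^ (-κ) * L l) ≤ ‖oscIntegral S φ l‖ := by
  classical
  -- Nothing is known of `S` outside `U`; extension by zero gives a measurable phase without
  -- changing the integral.
  set T : ℝ × ℝ → ℝ := U.piecewise S fun _ => 0 with hTdef
  have hT : Measurable T := hS.measurable_piecewise continuousOn_const hU.measurableSet
  have hST : ∀ p, φ p ≠ 0 → S p = T p := fun p hp => by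
    rw [hTdef, Set.piecewise_eq_of_mem _ _ _ (hφU (subset_tsupport φ hp))]
  rw [oscIntegral_congr_of_support hST]
  have hφi : Integrable φ := hφ.integrable_of_hasCompactSupport hφc
  obtain ⟨C, c, hC, hc, hgrow⟩ := h
  obtain ⟨ρ, hρ, hρφ⟩ := Metric.nhds_basis_closedBall.mem_iff.1
    (hφ.continuousAt.eventually (lt_mem_nhds (half_lt_self hφ0)))
  -- Sublevel growth is used at `t = 1 / (D * R)`: `D ≥ C` gives `|S| ≤ 1 / R`, and `D ≥ 1` gives `L
  -- R ≤ L (D * R)`.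
  set D := max C 1 with hDdef
  have hD1 : 1 ≤ D := le_max_right _ _
  have hD : 0 < D := by linarith
  have hten : Tendsto (fun R : ℝ => 1 / (D * R)) atTop (nhdsWithin 0 (Set.Ioi 0)) := by
    have := tendsto_inv_atTop_nhdsGT_zero.comp (tendsto_id.const_mul_atTop hD)
    simpa [Function.comp_def] using this
  refine exists_frequently_le_of_le_integral (κ := κ) (c := φ 0 / 8 * c * D ^ (-κ))
    (continuous_oscIntegral hT hφi).norm hκ (by positivity) hL hL1 ?_
  filter_upwards [hten.eventually (hgrow ρ hρ), eventually_ge_atTop 1] with R hR hR1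
  obtain ⟨A, hA, hAρ, hAS, hAv⟩ := hR
  have hR0 : 0 < R := by linarith
  have hAφ : ∀ p ∈ A, φ 0 / 2 < φ p := fun p hp => hρφ (hAρ hp)
  have hfin : volume A ≠ ⊤ :=
    ((measure_mono hAρ).trans_lt measure_closedBall_lt_top).ne
  refine le_trans ?_ (sublevel_le_integral_norm_oscIntegral (c := φ 0 / 2) hT hφi hφ_nonneg hR0
    (by positivity) hA hfin (fun p hp => ?_) fun p hp => (hAφ p hp).le)
  · have h1 : L R ≤ L (1 / (1 / (D * R))) := by
      rw [one_div_one_div]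
      exact hL hR1 (show 1 ≤ D * R by nlinarith) (by nlinarith)
    have h2 : (1 / (D * R)) ^ κ = D ^ (-κ) * R ^ (-κ) := by
      rw [one_div, Real.inv_rpow (by positivity), ← Real.rpow_neg (by positivity),
        Real.mul_rpow hD.le hR0.le]
    have h3 : R ^ (1 - κ) = R * R ^ (-κ) := by
      rw [sub_eq_add_neg, Real.rpow_add hR0, Real.rpow_one]
    have h4 : c * (D ^ (-κ) * R ^ (-κ) * L R) ≤ volume.real A := by
      refine le_trans ?_ hAv
      rw [h2]
      gcongr
    calc φ 0 / 8 * c * D ^ (-κ) * (R ^ (1 - κ) * L R)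
        = R / 4 * (φ 0 / 2) * (c * (D ^ (-κ) * R ^ (-κ) * L R)) := by rw [h3]; ring
      _ ≤ _ := by gcongr
  · have hp0 : φ p ≠ 0 := by linarith [hAφ p hp]
    rw [← hST p hp0]
    calc |S p| ≤ C * (1 / (D * R)) := hAS p hp
      _ ≤ D * (1 / (D * R)) := by gcongr; exact le_max_left _ _
      _ = 1 / R := by field_simp

theorem ofReal_le_limsup_enorm_div {J : ℝ → ℂ} {g : ℝ → ℝ} {ε : ℝ}
    (hg : ∀ᶠ l in atTop, 0 < g l) (h : ∃ᶠ l in atTop, ε * g l ≤ ‖J l‖) :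
    ENNReal.ofReal ε ≤ limsup (fun l : ℝ => ‖J l / ((g l : ℝ) : ℂ)‖ₑ) atTop := by
  refine le_limsup_of_frequently_le ?_ (by isBoundedDefault)
  refine (h.and_eventually hg).mono fun l hl => ?_
  rw [← ofReal_norm, norm_div, Complex.norm_real, Real.norm_of_nonneg hl.2.le]
  exact ENNReal.ofReal_le_ofReal ((le_div_iff₀ hl.2).2 hl.1)

theorem theorem1
    (U : Set (ℝ × ℝ)) (hU : IsOpen U) (h0U : (0 : ℝ × ℝ) ∈ U)
    (S : ℝ × ℝ → ℝ) (hS : ContDiffOn ℝ ∞ S U)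
    (hS0 : S 0 = 0) (hdS0 : fderiv ℝ S 0 = 0)
    (hTaylor : ∃ a b : ℕ, taylorCoeff₂ S a b ≠ 0)
    (hsuper : IsSuperadapted S) (hd : 1 < newtonDistance S)
    (φ : ℝ × ℝ → ℝ) (hφ : ContDiff ℝ ∞ φ) (hφc : HasCompactSupport φ)
    (hφU : tsupport φ ⊆ U) (hφ_nonneg : ∀ p, 0 ≤ φ p) (hφ0 : 0 < φ 0) :
    (NewtonCase1 S →
      0 < limsup (fun l : ℝ =>
        ‖oscIntegral S φ l / ((l ^ (-(1 / newtonDistance S)) : ℝ) : ℂ)‖ₑ) atTop) ∧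
    (NewtonCase2 S →
      0 < limsup (fun l : ℝ =>
        ‖oscIntegral S φ l /
          ((l ^ (-(1 / newtonDistance S)) * Real.log l : ℝ) : ℂ)‖ₑ) atTop) ∧
    (NewtonCase3 S →
      ∀ δ : ℝ, 0 < δ →
        limsup (fun l : ℝ =>
          ‖oscIntegral S φ l /
            ((l ^ (-(1 / newtonDistance S) - δ) : ℝ) : ℂ)‖ₑ) atTop = ⊤) := by
  have hd0 : 0 < newtonDistance S := by linarith
  have hd1 : 1 / newtonDistance S < 1 := (div_lt_one hd0).2 hd
  have main : ∀ {κ : ℝ} {L : ℝ → ℝ}, κ < 1 → MonotoneOn L (Set.Ici 1) →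
      (∀ᶠ R in atTop, 1 ≤ L R) → SublevelGrowth S κ L →
      ∃ ε : ℝ, 0 < ε ∧ ∃ᶠ l in atTop, ε * (l ^ (-κ) * L l) ≤ ‖oscIntegral S φ l‖ :=
    fun hκ hL hL1 h => h.exists_frequently_le_norm_oscIntegral hU hS.continuousOn
      hφ.continuous hφc hφU hφ_nonneg hφ0 hκ hL hL1
  refine ⟨fun h => ?_, fun h => ?_, fun h δ hδ => ?_⟩
  · obtain ⟨e, he, hcomp, hb⟩ := h
    obtain ⟨p, q, -, -, hpq, hw, hpos⟩ := he.exists_weights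
      (hb.mono (Set.inter_subset_inter_left _ Set.sdiff_subset)) hd0
    obtain ⟨hp, hq⟩ := hpos hcomp
    have hgrow := sublevelGrowth_of_weights hU h0U hS hp hq hw
    rw [hpq] at hgrow
    obtain ⟨ε, hε, hfreq⟩ := main hd1 monotoneOn_const (Eventually.of_forall fun _ => le_rfl) hgrow
    simp only [mul_one] at hfreq
    refine (ENNReal.ofReal_pos.2 hε).trans_le (ofReal_le_limsup_enorm_div ?_ hfreq)
    filter_upwards [eventually_gt_atTop 0] with l hl
    exact Real.rpow_pos_of_pos hl _
  · obtain ⟨m, M, hm, hmM, hw⟩ := h.exists_slopes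
    obtain ⟨ε, hε, hfreq⟩ := main hd1
      (fun x hx y _ hxy => Real.log_le_log (zero_lt_one.trans_le hx) hxy)
      (Real.tendsto_log_atTop.eventually_ge_atTop 1)
      (sublevelGrowth_of_slopes hU h0U hS hd0 hm hmM hw)
    refine (ENNReal.ofReal_pos.2 hε).trans_le (ofReal_le_limsup_enorm_div ?_ hfreq)
    filter_upwards [eventually_gt_atTop 1] with l hl
    exact mul_pos (Real.rpow_pos_of_pos (by linarith) _) (Real.log_pos hl)
  · obtain ⟨e, he, -, hb⟩ := h
    obtain ⟨p, q, hp, hq, hpq, hw, -⟩ := he.exists_weights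
      (hb.mono (Set.inter_subset_inter_left _ Set.sdiff_subset)) hd0
    -- Here `η / 2` is added to each weight to make both positive. The bounds on `η` keep the
    -- exponent `1 / d + η` below `1` and leave a spare factor `l ^ (δ - η)` that exceeds every
    -- constant.
    obtain ⟨η, hη, hη2⟩ := exists_between
      (lt_min (half_pos hδ) (sub_pos.2 hd1))
    have hηδ : η < δ := by linarith [hη2.trans_le (min_le_left _ _)]
    have hη1 : 1 / newtonDistance S + η < 1 := by linarith [hη2.trans_le (min_le_right _ _)]
    have hgrow := sublevelGrowth_of_weights hU h0U hS (p := p + η / 2) (q := q + η / 2)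
      (by positivity) (by positivity) fun a b hab => (hw a b hab).trans (by gcongr <;> linarith)
    rw [show p + η / 2 + (q + η / 2) = 1 / newtonDistance S + η by rw [← hpq]; ring] at hgrow
    obtain ⟨ε, hε, hfreq⟩ := main hη1 monotoneOn_const (Eventually.of_forall fun _ => le_rfl) hgrow
    simp only [mul_one] at hfreq
    refine ENNReal.eq_top_of_forall_nnreal_le fun K => ?_
    rw [← ENNReal.ofReal_coe_nnreal]
    refine ofReal_le_limsup_enorm_div ?_ ?_
    · filter_upwards [eventually_gt_atTop 0] with l hl
      exact Real.rpow_pos_of_pos hl _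
    · refine (hfreq.and_eventually ((eventually_gt_atTop 0).and
        ((tendsto_rpow_atTop (sub_pos.2 hηδ)).eventually_ge_atTop (K / ε)))).mono fun l hl => ?_
      obtain ⟨h1, hl0, h2⟩ := hl
      rw [div_le_iff₀ hε] at h2
      have h3 : l ^ (-(1 / newtonDistance S + η))
          = l ^ (δ - η) * l ^ (-(1 / newtonDistance S) - δ) := by
        rw [← Real.rpow_add hl0]; ring_nf
      refine le_trans ?_ h1
      rw [h3, ← mul_assoc]
      exact mul_le_mul_of_nonneg_right (by linarith) (Real.rpow_nonneg hl0.le _)
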